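/- Consider a network $\Sigma$ of $n$ first-order subsystems with trivial internal dynamics and $m$ inputs, $\dot x_i=\sum_{j\ne i}a_{ij}x_j+\sum_{s=1}^m b_{i,s}u_s$ with outputs $y_i=x_i$ ($i=1,\dots,n$), as a structured system: a given set of the $a_{ij}$, $i\neq j$, and of the $b_{i,s}$ are free real parameters and all the others are fixed to zero. Its graph $\mathrm G(\Sigma)$ has state nodes $x_1,\dots,x_n$, input nodes $u_1,\dots,u_m$, an edge $x_j\to x_i$ for every free $a_{ij}$ and an edge $u_s\to x_i$ for every free $b_{i,s}$. A stem is a path with distinct nodes that starts at an input node and ends at a state node; a cycle is an elementary directed cycle. $\Sigma$ is input-accessible if every state node is the end of a stem. An input-accessible $\Sigma$ is a Y-network if every set of stems and cycles covering all state nodes includes two different stems originated from the same input node, and no such set includes (1) a stem and a cycle with a common node, (2) two different cycles with a common node, or (3) two stems with a common node originated from different input nodes. An extended system $\hat\Sigma$ of $\Sigma$ replaces each subsystem $i$ by one of some order $\hat n_i\ge 1$, $\dot{\hat x}_i=\hat a_i\hat x_i+\sum_{j\neq i}\hat a_{ij}\hat x_j+\sum_s\hat b_{i,s}u_s$, $\hat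 y_i=\hat c_i\hat x_i$, $\hat x_i\in\mathbb R^{\hat n_i}$. The entries of $\hat a_{ij}\in\mathbb R^{\hat n_i\times\hat n_j}$ ($i\ne j$) and of $\hat b_{i,s}\in\mathbb R^{\hat n_i}$ are free or fixed to zero, and may be free only if $a_{ij}$, respectively $b_{i,s}$, is free in $\Sigma$. Each $\hat a_i\in\mathbb R^{\hat n_i\times\hat n_i}$ has either all entries free (heterogeneous internal dynamics) or all entries fixed to zero (homogeneous, trivial internal dynamics). The row $\hat c_i\in\mathbb R^{1\times\hat n_i}$ is free if $\hat n_i>1$, and $\hat c_i=1$ if $\hat n_i=1$. With $\hat A,\hat B,\hat C$ the resulting block matrices ($\hat C$ block diagonal) and $\hat n=\sum_i\hat n_i$, $\hat\Sigma$ is structurally output controllable if for some real values of the free parameters the matrix $\hat C\,[\hat B\ \ \hat A\hat B\ \cdots\ \hat A^{\hat n-1}\hat B]$ has full row rank $n$. Let $\Sigma$ be a Y-network. Then no extended system $\hat\Sigma$ of $\Sigma$ all of whose subsystems have homogeneous internal dynamics is structurally output controllable. Consequently, every structurally output controllable extended system of $\Sigma$ has at least one subsystem with heterogeneous internal dynamics.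 -/

import Mathlib

namespace NetCtrl

/-- The status of an entry of a structured matrix: fixed to zero, fixed to one, or generic
(a free real parameter). -/
inductive Entry where
  | zero
  | one
  | free

/-- The real values that an entry of a structured matrix may take. -/
def Entry.Admits : Entry → ℝ → Prop
  | .zero, r => r = 0
  | .one, r => r = 1
  | .free, _ => True

/-- The real matrix `M` is a numerical realization of the structured matrix `P`. -/
def IsRealization {α β : Type*} (P : Matrix α β Entry) (M : Matrix α β ℝ) : Prop :=
  ∀ i j, (P i j).Admits (M i j)

/-- The controllability matrix `[B  AB  ⋯  A^(d-1) B]`, where `d` is the number of states; its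
columns are indexed by the power of `A` and the column of `B`. -/
def controllabilityMatrix {ι κ : Type*} [Fintype ι] [DecidableEq ι]
    (A : Matrix ι ι ℝ) (B : Matrix ι κ ℝ) : Matrix ι (Fin (Fintype.card ι) × κ) ℝ :=
  Matrix.of fun i c => (A ^ (c.1 : ℕ) * B) i c.2

/-- A structured linear system `x' = A x + B u`, `y = C x`, with states `ι`, inputs `κ` and
outputs `ο`. -/
structure StructuredSystem (ι κ ο : Type*) where
  A : Matrix ι ι Entry
  B : Matrix ι κ Entry
  C : Matrix ο ι Entry

namespace StructuredSystem

variable {ι κ ο : Type*}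

/-- Some numerical realization has an output controllability matrix `C * [B  AB  ⋯  A^(d-1) B]`
of full row rank. -/
def StructurallyOutputControllable [Fintype ι] [DecidableEq ι] [Fintype κ] [Fintype ο]
    (S : StructuredSystem ι κ ο) : Prop :=
  ∃ (A : Matrix ι ι ℝ) (B : Matrix ι κ ℝ) (C : Matrix ο ι ℝ),
    IsRealization S.A A ∧ IsRealization S.B B ∧ IsRealization S.C C ∧
      (C * controllabilityMatrix A B).rank = Fintype.card ο

/-- The directed graph of a structured system: state nodes `Sum.inl x`, input nodes `Sum.inr u`,
an edge from state `x` to state `y` when the entry `A y x` is not fixed to zero, an edge from input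
`u` to state `x` when the entry `B x u` is not fixed to zero, and no edges into input nodes. -/
def graph (S : StructuredSystem ι κ ο) : Digraph (ι ⊕ κ) where
  Adj v w := match v, w with
    | .inl x, .inl y => S.A y x ≠ Entry.zero
    | .inr u, .inl x => S.B x u ≠ Entry.zero
    | _, .inr _ => False

end StructuredSystem

section Paths

variable {X U : Type*}

/-- `p` starts at the input node `u`. -/
def OriginatesFrom (p : List (X ⊕ U)) (u : U) : Prop :=
  p.head? = some (Sum.inr u)

/-- `p` ends at the state node `x`. -/
def EndsAt (p : List (X ⊕ U)) (x : X) : Prop :=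
  p.getLast? = some (Sum.inl x)

/-- A stem: a path of distinct nodes from an input node to a state node. -/
def IsStem (G : Digraph (X ⊕ U)) (p : List (X ⊕ U)) : Prop :=
  p.Nodup ∧ p.IsChain G.Adj ∧ (∃ u, OriginatesFrom p u) ∧ ∃ x, EndsAt p x

/-- An elementary cycle: a nonempty cyclic sequence of distinct nodes, each joined to the next
(and the last to the first) by an edge. The repeated last node is not written, and cyclic rotations
of a sequence are the same cycle. -/
def IsElementaryCycle (G : Digraph (X ⊕ U)) (c : Cycle (X ⊕ U)) : Prop :=
  c ≠ Cycle.nil ∧ c.Nodup ∧ c.Chain G.Adj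

/-- Every state node is the end vertex of a stem. -/
def InputAccessible (G : Digraph (X ⊕ U)) : Prop :=
  ∀ x : X, ∃ p, IsStem G p ∧ EndsAt p x

/-- A set of stems and elementary cycles of `G`. -/
structure StemCycleSet (G : Digraph (X ⊕ U)) where
  stems : Set (List (X ⊕ U))
  cycles : Set (Cycle (X ⊕ U))
  isStem : ∀ p ∈ stems, IsStem G p
  isElementaryCycle : ∀ c ∈ cycles, IsElementaryCycle G c

namespace StemCycleSet

variable {G : Digraph (X ⊕ U)}

/-- Every state node lies on a member of the set. -/
def CoversStates (P : StemCycleSet G) : Prop :=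
  ∀ x : X, (∃ p ∈ P.stems, Sum.inl x ∈ p) ∨ (∃ c ∈ P.cycles, Sum.inl x ∈ c)

/-- The set includes a stem and a cycle intersecting at some node. -/
def StemMeetsCycle (P : StemCycleSet G) : Prop :=
  ∃ p ∈ P.stems, ∃ c ∈ P.cycles, ∃ w, w ∈ p ∧ w ∈ c

/-- The set includes two cycles intersecting at some node. -/
def CyclesMeet (P : StemCycleSet G) : Prop :=
  ∃ c ∈ P.cycles, ∃ d ∈ P.cycles, c ≠ d ∧ ∃ w, w ∈ c ∧ w ∈ d

/-- The set includes two stems, intersecting at some node, originated from different input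
nodes. -/
def StemsFromDifferentInputsMeet (P : StemCycleSet G) : Prop :=
  ∃ p ∈ P.stems, ∃ q ∈ P.stems, ∃ u v, OriginatesFrom p u ∧ OriginatesFrom q v ∧ u ≠ v ∧
    ∃ w, w ∈ p ∧ w ∈ q

/-- The set includes two stems originated from the same input node. -/
def StemsShareInput (P : StemCycleSet G) : Prop :=
  ∃ p ∈ P.stems, ∃ q ∈ P.stems, p ≠ q ∧ ∃ u, OriginatesFrom p u ∧ OriginatesFrom q u

end StemCycleSet

end Paths

/-- A network of `n` identical first-order subsystems with trivial internal dynamics and `m`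
inputs. `interconnection j i` says that subsystem `j` acts on subsystem `i` (the weight `a i j` is
free); only pairs `j ≠ i` matter. `inputLink s i` says that input `s` acts on subsystem `i` (the
entry `b i s` is free). -/
structure Network (n m : ℕ) where
  interconnection : Fin n → Fin n → Prop
  inputLink : Fin m → Fin n → Prop

namespace Network

variable {n m : ℕ}

open scoped Classical in
/-- The structured system of a network: zero diagonal, and `C` is the identity matrix. -/
noncomputable def system (N : Network n m) : StructuredSystem (Fin n) (Fin m) (Fin n) where
  A := Matrix.of fun i j => if i ≠ j ∧ N.interconnection j i then Entry.free else Entry.zero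
  B := Matrix.of fun i s => if N.inputLink s i then Entry.free else Entry.zero
  C := Matrix.of fun i j => if i = j then Entry.one else Entry.zero

/-- An input-accessible network such that every set of stems and cycles covering the state nodes
includes two stems originated from the same input node, and none includes a stem meeting a cycle,
two cycles that meet, or two stems from different inputs that meet. -/
def IsYNetwork (N : Network n m) : Prop :=
  InputAccessible N.system.graph ∧
    ∀ P : StemCycleSet N.system.graph, P.CoversStates →
      P.StemsShareInput ∧ ¬ P.StemMeetsCycle ∧ ¬ P.CyclesMeet ∧ ¬ P.StemsFromDifferentInputsMeet

/-- An extended system of the network `N`: subsystem `i` gets order `order i ≥ 1`, with state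
variables `⟨i, k⟩`. The weights between state variables of different subsystems are free or fixed
to zero (`link p q`: the weight from `p` to `q` is free), and may be free only where `N` has an
interconnection; likewise for the input weights. The internal dynamics of a subsystem is a matrix
that is entirely generic (`i ∈ heterogeneous`) or entirely fixed to zero (`i ∉ heterogeneous`). -/
structure ExtendedSystem (N : Network n m) where
  order : Fin n → ℕ
  one_le_order : ∀ i, 1 ≤ order i
  heterogeneous : Set (Fin n)
  link : (Σ i, Fin (order i)) → (Σ i, Fin (order i)) → Prop
  link_local : ∀ p q, link p q → p.1 ≠ q.1 ∧ N.interconnection p.1 q.1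
  inputLink : Fin m → (Σ i, Fin (order i)) → Prop
  inputLink_local : ∀ s p, inputLink s p → N.inputLink s p.1

namespace ExtendedSystem

variable {N : Network n m}

/-- The state variables of the extended system. -/
abbrev State (E : N.ExtendedSystem) : Type := Σ i, Fin (E.order i)

open scoped Classical in
/-- The structured system of an extended system. The output matrix is block diagonal; the block of
subsystem `i` is a generic row if the order of `i` is more than one, and `1` otherwise. -/
noncomputable def system (E : N.ExtendedSystem) :
    StructuredSystem E.State (Fin m) (Fin n) where
  A := Matrix.of fun p q =>
    if p.1 = q.1 then (if p.1 ∈ E.heterogeneous then Entry.free else Entry.zero)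
    else (if E.link q p then Entry.free else Entry.zero)
  B := Matrix.of fun p s => if E.inputLink s p then Entry.free else Entry.zero
  C := Matrix.of fun i p =>
    if p.1 = i then (if 1 < E.order i then Entry.free else Entry.one) else Entry.zero

/-- All subsystems have homogeneous (trivial) internal dynamics. -/
def IsHomogeneous (E : N.ExtendedSystem) : Prop :=
  ∀ i, i ∉ E.heterogeneous

end ExtendedSystem

end Network

end NetCtrl

namespace NetCtrl

/-! ### Stems and their extension along edges. -/

section Stems

variable {X U : Type*} {G : Digraph (X ⊕ U)}

/-! With trivial internal dynamics, a nonzero entry of `A ^ k * B` yields a walk with `k + 2` nodes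
in the graph of `N`. In a Y-network no stem meets a cycle, so the walk never repeats a node and is a
stem (`IsStem.concat`). Each state is reached from a single input, so the output rows in `reach u`
involve only columns of input `u` whose power `k` is at most the longest stem length minus 2.

Taking one longest stem per input gives a set in which no two stems share an input, so it misses a
state `x`. For the input `u` that reaches `x`, the longest stem then has at most `(reach u).card`
nodes, input included. Hence `(reach u).card` rows are supported on at most `(reach u).card - 1`
columns, and full row rank fails. -/

theorem IsStem.prefix_of_mem {p : List (X ⊕ U)} (hp : IsStem G p) {u : U}
    (hu : OriginatesFrom p u) {x : X} (hx : Sum.inl x ∈ p) :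
    ∃ q, IsStem G q ∧ OriginatesFrom q u ∧ EndsAt q x := by
  obtain ⟨a, b, rfl⟩ := List.append_of_mem hx
  obtain ⟨hnd, hch, -, -⟩ := hp
  have hpre : (a ++ [Sum.inl x]) <+: (a ++ Sum.inl x :: b) := ⟨b, by simp⟩
  have ho : OriginatesFrom (a ++ [Sum.inl x]) u := by
    cases a <;> simp_all [OriginatesFrom]
  have he : EndsAt (a ++ [Sum.inl x] : List (X ⊕ U)) x := by simp [EndsAt]
  exact ⟨_, ⟨hnd.sublist hpre.sublist, hch.prefix hpre, ⟨u, ho⟩, ⟨x, he⟩⟩, ho, he⟩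

theorem OriginatesFrom.eq_of_mem (hG : ∀ v u, ¬ G.Adj v (Sum.inr u)) {p : List (X ⊕ U)}
    (hp : p.IsChain G.Adj) {u v : U} (hu : OriginatesFrom p u) (hv : Sum.inr v ∈ p) : v = u := by
  obtain ⟨a, b, rfl⟩ := List.append_of_mem hv
  rcases List.eq_nil_or_concat a with rfl | ⟨a', w, rfl⟩
  · simpa [OriginatesFrom] using hu
  · exfalso
    have h : [w, Sum.inr v] <:+: (a'.concat w ++ Sum.inr v :: b) := ⟨a', b, by simp⟩
    exact hG w v (by simpa using hp.infix h)

/-- If no stem meets a cycle, an edge leaving the end of a stem extends it to a longer stem. -/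
theorem IsStem.concat (hG : ∀ p, IsStem G p → ∀ c, IsElementaryCycle G c → ∀ w ∈ p, w ∉ c)
    {p : List (X ⊕ U)} (hp : IsStem G p) {u : U} (hu : OriginatesFrom p u) {x y : X}
    (hx : EndsAt p x) (hxy : G.Adj (Sum.inl x) (Sum.inl y)) :
    IsStem G (p ++ [Sum.inl y]) ∧ OriginatesFrom (p ++ [Sum.inl y]) u ∧
      EndsAt (p ++ [Sum.inl y]) y := by
  have ho : OriginatesFrom (p ++ [Sum.inl y]) u := by
    cases p <;> simp_all [OriginatesFrom]
  have he : EndsAt (p ++ [Sum.inl y]) y := by simp [EndsAt]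
  have hy : Sum.inl y ∉ p := by
    intro hmem
    have hstem := hp
    obtain ⟨a, b, rfl⟩ := List.append_of_mem hmem
    obtain ⟨hnd, hch, -, -⟩ := hp
    have hsuf : (Sum.inl y :: b) <:+ (a ++ Sum.inl y :: b) := ⟨a, rfl⟩
    -- The part of `p` from `y` to its end `x`, closed by the edge `x → y`, would be a cycle meeting
    -- the stem `p`.
    refine hG _ hstem (↑(Sum.inl y :: b : List (X ⊕ U))) ⟨?_, ?_, ?_⟩ (Sum.inl y) hmem (by simp)
    · simp
    · simpa using hnd.sublist hsuf.sublist
    · have hl : (Sum.inl x : X ⊕ U) ∈ (Sum.inl y :: b).getLast? := by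
        simpa [EndsAt, List.getLast?_append] using hx
      rw [Cycle.chain_coe_cons, ← List.cons_append, List.isChain_append]
      refine ⟨hch.suffix hsuf, by simp, ?_⟩
      intro v hv w hw
      obtain rfl := Option.mem_unique hv hl
      simp only [List.head?_cons, Option.mem_def, Option.some.injEq] at hw
      exact hw ▸ hxy
  refine ⟨⟨?_, ?_, ⟨u, ho⟩, ⟨y, he⟩⟩, ho, he⟩
  · rw [List.nodup_append]
    refine ⟨hp.1, by simp, ?_⟩
    rintro v hv w hw rfl
    exact hy (by simpa [List.mem_singleton.1 hw] using hv)
  · rw [List.isChain_append]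
    refine ⟨hp.2.1, by simp, ?_⟩
    intro v hv w hw
    obtain rfl := Option.mem_unique hv hx
    simp only [List.head?_cons, Option.mem_def, Option.some.injEq] at hw
    exact hw ▸ hxy

/-- The stems originated from `u`, if there are any, include a longest one. -/
theorem exists_longest_stem [Fintype X] [Fintype U] {u : U} {p : List (X ⊕ U)} (hp : IsStem G p)
    (hu : OriginatesFrom p u) :
    ∃ q, (IsStem G q ∧ OriginatesFrom q u) ∧
      ∀ r, IsStem G r → OriginatesFrom r u → r.length ≤ q.length := by
  classical
  let P : ℕ → Prop := fun k => ∃ q, (IsStem G q ∧ OriginatesFrom q u) ∧ q.length = k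
  have hbound : ∀ r, IsStem G r → r.length ≤ Fintype.card (X ⊕ U) :=
    fun r hr => hr.1.length_le_card
  have hex : P (Nat.findGreatest P (Fintype.card (X ⊕ U))) :=
    Nat.findGreatest_spec (hbound p hp) ⟨p, ⟨hp, hu⟩, rfl⟩
  obtain ⟨q, hq, hlen⟩ := hex
  exact ⟨q, hq, fun r hr hru =>
    hlen ▸ Nat.le_findGreatest (hbound r hr) ⟨r, ⟨hr, hru⟩, rfl⟩⟩

end Stems

/-- If the rows in `s` of a matrix with linearly independent rows vanish outside the columns in
`t`, then `s` has at most as many elements as `t`. -/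
theorem card_le_card_of_linearIndependent_row {α β : Type*} [Fintype α] [Fintype β]
    {M : Matrix α β ℝ} (hM : LinearIndependent ℝ M.row) (s : Finset α) (t : Finset β)
    (h : ∀ i ∈ s, ∀ j, M i j ≠ 0 → j ∈ t) : s.card ≤ t.card := by
  have hs : LinearIndependent ℝ fun i : s => M i := hM.comp _ Subtype.val_injective
  -- Only zero coordinates are dropped, so these rows stay independent in a space of dimension
  -- `t.card`.
  have hst : LinearIndependent ℝ fun (i : s) (j : t) => M i j := by
    rw [Fintype.linearIndependent_iff] at hs ⊢
    intro g hg
    refine hs g (funext fun j => ?_)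
    by_cases hj : j ∈ t
    · simpa using congrFun hg ⟨j, hj⟩
    · rw [Finset.sum_apply]
      refine Finset.sum_eq_zero fun i _ => ?_
      have : M i j = 0 := by_contra fun hne => hj (h i i.2 j hne)
      simp [this]
  simpa using hst.fintype_card_le_finrank

/-! ### Stems of a Y-network. -/

namespace Network

variable {n m : ℕ} {N : Network n m}

theorem not_graph_adj_inr (N : Network n m) (v : Fin n ⊕ Fin m) (u : Fin m) :
    ¬ N.system.graph.Adj v (Sum.inr u) := by
  cases v <;> simp [StructuredSystem.graph]

/-- The set of all stems and all elementary cycles. -/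
def allStemsAndCycles (N : Network n m) : StemCycleSet N.system.graph where
  stems := {p | IsStem N.system.graph p}
  cycles := {c | IsElementaryCycle N.system.graph c}
  isStem _ h := h
  isElementaryCycle _ h := h

/-- Applied to this largest covering set, the three prohibitions hold for all stems and cycles of
the graph. -/
theorem IsYNetwork.allStemsAndCycles_coversStates (hN : N.IsYNetwork) :
    N.allStemsAndCycles.CoversStates := fun x => by
  obtain ⟨p, hp, hx⟩ := hN.1 x
  exact Or.inl ⟨p, hp, List.mem_of_getLast? hx⟩

theorem IsYNetwork.notMem_cycle (hN : N.IsYNetwork) (p) (hp : IsStem N.system.graph p) (c)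
    (hc : IsElementaryCycle N.system.graph c) (w) (hw : w ∈ p) : w ∉ c := fun hwc =>
  (hN.2 _ hN.allStemsAndCycles_coversStates).2.1 ⟨p, hp, c, hc, w, hw, hwc⟩

theorem IsYNetwork.input_unique (hN : N.IsYNetwork) {p q} (hp : IsStem N.system.graph p)
    (hq : IsStem N.system.graph q) {u v : Fin m} (hu : OriginatesFrom p u)
    (hv : OriginatesFrom q v) {x : Fin n} (hpx : EndsAt p x) (hqx : EndsAt q x) : u = v := by
  by_contra huv
  exact (hN.2 _ hN.allStemsAndCycles_coversStates).2.2.2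
    ⟨p, hp, q, hq, u, v, hu, hv, huv, Sum.inl x, List.mem_of_getLast? hpx,
      List.mem_of_getLast? hqx⟩

open scoped Classical in
/-- The states at the end of a stem originated from `u`. -/
noncomputable def reach (N : Network n m) (u : Fin m) : Finset (Fin n) :=
  Finset.univ.filter fun x => ∃ p, IsStem N.system.graph p ∧ OriginatesFrom p u ∧ EndsAt p x

theorem mem_reach {u : Fin m} {x : Fin n} :
    x ∈ N.reach u ↔ ∃ p, IsStem N.system.graph p ∧ OriginatesFrom p u ∧ EndsAt p x := by
  simp [reach]

/-- In a Y-network the states reached from some input are too many for a single stem. -/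
theorem IsYNetwork.exists_length_le_card_reach (hN : N.IsYNetwork) :
    ∃ u, 0 < (N.reach u).card ∧
      ∀ p, IsStem N.system.graph p → OriginatesFrom p u → p.length ≤ (N.reach u).card := by
  classical
  -- The implication makes the choice total: an input without stems gets the harmless value `[]`.
  have hlong : ∀ u, ∃ q, ∀ p, IsStem N.system.graph p → OriginatesFrom p u →
      (IsStem N.system.graph q ∧ OriginatesFrom q u) ∧ p.length ≤ q.length := by
    intro u
    by_cases hu : ∃ p, IsStem N.system.graph p ∧ OriginatesFrom p u
    · obtain ⟨p, hp, hpu⟩ := hu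
      obtain ⟨q, hq, hmax⟩ := exists_longest_stem hp hpu
      exact ⟨q, fun r hr hru => ⟨hq, hmax r hr hru⟩⟩
    · exact ⟨[], fun p hp hpu => absurd ⟨p, hp, hpu⟩ hu⟩
  choose q hq using hlong
  let P : StemCycleSet N.system.graph :=
    { stems := {p | ∃ u, p = q u ∧ IsStem N.system.graph p ∧ OriginatesFrom p u}
      cycles := ∅
      isStem := fun p hp => hp.choose_spec.2.1
      isElementaryCycle := fun c hc => absurd hc (Set.notMem_empty c) }
  have hcover : ¬ P.CoversStates := by
    intro hP
    obtain ⟨p, ⟨u, hpu, -, hu⟩, p', ⟨u', hpu', -, hu'⟩, hne, v, hv, hv'⟩ := (hN.2 P hP).1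
    have h1 : u = v := by simpa [OriginatesFrom] using hu.symm.trans hv
    have h2 : u' = v := by simpa [OriginatesFrom] using hu'.symm.trans hv'
    exact hne (by rw [hpu, hpu', h1, h2])
  obtain ⟨x, hx⟩ := not_forall.1 hcover
  obtain ⟨p, hp, hpx⟩ := hN.1 x
  obtain ⟨u, hpu⟩ := hp.2.2.1
  have hxu : x ∈ N.reach u := mem_reach.2 ⟨p, hp, hpu, hpx⟩
  obtain ⟨⟨hs, ho⟩, -⟩ := hq u p hp hpu
  have hxq : Sum.inl x ∉ q u := fun hmem => hx (Or.inl ⟨q u, ⟨u, rfl, hs, ho⟩, hmem⟩)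
  have hpos : 0 < (N.reach u).card := Finset.card_pos.2 ⟨x, hxu⟩
  refine ⟨u, hpos, fun r hr hru => (hq u r hr hru).2.trans ?_⟩
  -- The input node counted in the length is offset by the missed state `x`.
  have hsub : (q u).toFinset ⊆
      insert (Sum.inr u) (((N.reach u).erase x).image (Sum.inl : Fin n → Fin n ⊕ Fin m)) := by
    intro w hw
    rw [List.mem_toFinset] at hw
    rcases w with y | v
    · refine Finset.mem_insert_of_mem (Finset.mem_image_of_mem _ (Finset.mem_erase.2 ⟨?_, ?_⟩))
      · rintro rfl
        exact hxq hw
      · exact mem_reach.2 (hs.prefix_of_mem ho hw)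
    · rw [ho.eq_of_mem N.not_graph_adj_inr hs.2.1 hw]
      exact Finset.mem_insert_self _ _
  calc (q u).length = (q u).toFinset.card := (List.toFinset_card_of_nodup hs.1).symm
    _ ≤ _ := Finset.card_le_card hsub
    _ ≤ ((N.reach u).erase x).card + 1 :=
      (Finset.card_insert_le _ _).trans (Nat.add_le_add_right Finset.card_image_le 1)
    _ = (N.reach u).card := Finset.card_erase_add_one hxu

/-! ### Supports of the realized matrices of an extended system. -/

namespace ExtendedSystem

variable {E : N.ExtendedSystem}

/-- Homogeneity enters here: diagonal blocks vanish, so no step of a walk stays inside a subsystem.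
-/
theorem IsHomogeneous.graph_adj_of_ne_zero (hE : E.IsHomogeneous) {A : Matrix E.State E.State ℝ}
    (hA : IsRealization E.system.A A) {p q : E.State} (h : A p q ≠ 0) :
    N.system.graph.Adj (Sum.inl q.1) (Sum.inl p.1) := by
  have := hA p q
  by_cases hpq : p.1 = q.1
  · exact absurd (by simpa [system, hpq, hE q.1, Entry.Admits] using this) h
  · by_cases hl : E.link q p
    · simp [StructuredSystem.graph, Network.system, hpq, (E.link_local q p hl).2]
    · exact absurd (by simpa [system, hpq, hl, Entry.Admits] using this) h

theorem graph_adj_of_input_ne_zero {B : Matrix E.State (Fin m) ℝ}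
    (hB : IsRealization E.system.B B) {p : E.State} {s : Fin m} (h : B p s ≠ 0) :
    N.system.graph.Adj (Sum.inr s) (Sum.inl p.1) := by
  have := hB p s
  by_cases hl : E.inputLink s p
  · simp [StructuredSystem.graph, Network.system, E.inputLink_local s p hl]
  · exact absurd (by simpa [system, hl, Entry.Admits] using this) h

theorem eq_of_output_ne_zero {C : Matrix (Fin n) E.State ℝ} (hC : IsRealization E.system.C C)
    {i : Fin n} {p : E.State} (h : C i p ≠ 0) : p.1 = i := by
  have := hC i p
  by_contra hpi
  exact h (by simpa [system, hpi, Entry.Admits] using this)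

/-- A nonzero entry of `A ^ k * B` is witnessed by a stem with `k + 2` nodes. -/
theorem IsHomogeneous.exists_stem_of_ne_zero (hE : E.IsHomogeneous) (hN : N.IsYNetwork)
    {A : Matrix E.State E.State ℝ} {B : Matrix E.State (Fin m) ℝ}
    (hA : IsRealization E.system.A A) (hB : IsRealization E.system.B B) (k : ℕ) {p : E.State}
    {s : Fin m} (h : (A ^ k * B) p s ≠ 0) :
    ∃ w, IsStem N.system.graph w ∧ OriginatesFrom w s ∧ EndsAt w p.1 ∧ w.length = k + 2 := by
  induction k generalizing p with
  | zero =>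
    rw [pow_zero, Matrix.one_mul] at h
    have hadj := graph_adj_of_input_ne_zero hB h
    exact ⟨[Sum.inr s, Sum.inl p.1], ⟨by simp, by simpa using hadj, ⟨s, rfl⟩, ⟨p.1, rfl⟩⟩,
      rfl, rfl, rfl⟩
  | succ k ih =>
    rw [pow_succ', Matrix.mul_assoc, Matrix.mul_apply] at h
    obtain ⟨q, -, hq⟩ := Finset.exists_ne_zero_of_sum_ne_zero h
    obtain ⟨w, hw, hs, hwq, hlen⟩ := ih (right_ne_zero_of_mul hq)
    obtain ⟨h1, h2, h3⟩ := hw.concat hN.notMem_cycle hs hwq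
      (hE.graph_adj_of_ne_zero hA (left_ne_zero_of_mul hq))
    exact ⟨_, h1, h2, h3, by simp [hlen]⟩

theorem IsHomogeneous.not_structurallyOutputControllable (hE : E.IsHomogeneous)
    (hN : N.IsYNetwork) : ¬ E.system.StructurallyOutputControllable := by
  classical
  rintro ⟨A, B, C, hA, hB, hC, hrank⟩
  set M := C * controllabilityMatrix A B with hM
  have hind : LinearIndependent ℝ M.row := by
    rw [linearIndependent_iff_card_eq_finrank_span, ← hrank, Matrix.rank_eq_finrank_span_row,
      Set.finrank]
  obtain ⟨u, hpos, hu⟩ := hN.exists_length_le_card_reach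
  let t : Finset (Fin (Fintype.card E.State) × Fin m) :=
    Finset.univ.filter fun c => c.2 = u ∧ (c.1 : ℕ) + 2 ≤ (N.reach u).card
  have hst : (N.reach u).card ≤ t.card := by
    refine card_le_card_of_linearIndependent_row hind _ _ fun i hi c hne => ?_
    rw [hM, Matrix.mul_apply] at hne
    obtain ⟨p, -, hp⟩ := Finset.exists_ne_zero_of_sum_ne_zero hne
    -- `C` is block diagonal, so output `i` only sees state variables of subsystem `i`, whatever its
    -- order.
    obtain rfl := eq_of_output_ne_zero hC (left_ne_zero_of_mul hp)
    obtain ⟨w, hw, hs, hwp, hlen⟩ :=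
      hE.exists_stem_of_ne_zero hN hA hB c.1 (right_ne_zero_of_mul hp)
    obtain ⟨w', hw', hs', hwp'⟩ := mem_reach.1 hi
    have hcu : c.2 = u := hN.input_unique hw hw' hs hs' hwp hwp'
    exact Finset.mem_filter.2 ⟨Finset.mem_univ _, hcu, hlen ▸ hu w hw (hcu ▸ hs)⟩
  -- On `t` the input is fixed, so the power determines the column, and it is at most `(N.reach
  -- u).card - 2`. By `hpos` the truncated subtraction does no harm.
  have ht : t.card ≤ (Finset.range ((N.reach u).card - 1)).card := by
    refine Finset.card_le_card_of_injOn (fun c => (c.1 : ℕ)) ?_ ?_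
    · intro c hc
      have := (Finset.mem_filter.1 hc).2.2
      simp only [Finset.coe_range, Set.mem_Iio]
      omega
    · intro c hc d hd hcd
      exact Prod.ext (Fin.ext hcd)
        ((Finset.mem_filter.1 hc).2.1.trans (Finset.mem_filter.1 hd).2.1.symm)
  rw [Finset.card_range] at ht
  omega

end ExtendedSystem

end Network

end NetCtrl

theorem proposition2 {n m : ℕ} (N : NetCtrl.Network n m) (hN : N.IsYNetwork) :
    (∀ E : N.ExtendedSystem, E.IsHomogeneous → ¬ E.system.StructurallyOutputControllable) ∧
    (∀ E : N.ExtendedSystem, E.system.StructurallyOutputControllable →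
      ∃ i, i ∈ E.heterogeneous) := by
  refine ⟨fun E hE => hE.not_structurallyOutputControllable hN, fun E hE => ?_⟩
  by_contra! h
  exact NetCtrl.Network.ExtendedSystem.IsHomogeneous.not_structurallyOutputControllable h hN hE
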